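/- Let $C[0,1]$ be the space of continuous maps $f:[0,1]\to[0,1]$ with the topology of uniform convergence; a property is called typical if it holds for every $f$ in some dense $G_\delta$ subset of $C[0,1]$. Let $\{\Psi_i\}_{i\ge 1}$ be a dense sequence in $C[0,1]$ and, for Borel probability measures $\mu,\nu$ on $[0,1]$, let $$\operatorname{dist}(\mu,\nu)=\sum_{i=1}^\infty \frac1{2^i}\left|\int\Psi_i\,d\mu-\int\Psi_i\,d\nu\right| ,$$ a metric that induces the weak$^*$ topology. For $f\in C[0,1]$ and $x\in[0,1]$, let $p\omega(x)$ be the set of weak$^*$ limits of convergent subsequences of $\left\{\frac1n\sum_{j=0}^{n-1}\delta_{f^j(x)}\right\}_{n\ge1}$. A Borel probability measure $\mu$ on $[0,1]$ is pseudo-physical for $f$ if for every $\varepsilon>0$ the set $\{x\in[0,1]:\operatorname{dist}(p\omega(x),\mu)<\varepsilon\}$ has positive Lebesgue measure, where $\operatorname{dist}(p\omega(x),\mu)=\inf_{\nu\in p\omega(x)}\operatorname{dist}(\nu,\mu)$. Let $\mathcal O_f$ be the set of pseudo-physical measures for $f$, and let $\mathcal M_f$ be the space of $f$-invariant Borel probability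 measures with the weak$^*$ topology. **Theorem.** For a typical $f\in C[0,1]$, $\mathcal O_f$ is contained in $\mathcal M_f$, and it is a closed subset of $\mathcal M_f$ with empty interior in $\mathcal M_f$. Hence $\mathcal O_f$ is meager in $\mathcal M_f$, and $\mathcal M_f\setminus\mathcal O_f$ is dense in $\mathcal M_f$. -/

import Mathlib

open MeasureTheory Filter Topology
open scoped unitInterval ENNReal

noncomputable section

namespace IntervalDynamics

/-- A property of continuous maps `[0,1] → [0,1]` is typical if it holds for all maps in some
dense `G_δ` subset of `C([0,1],[0,1])` (topology of uniform convergence). -/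
def IsTypical (P : C(I, I) → Prop) : Prop :=
  ∃ G : Set C(I, I), IsGδ G ∧ Dense G ∧ ∀ f ∈ G, P f

/-- `∑_{i ≥ 1} 2^{-i} |∫ Ψ_i dμ - ∫ Ψ_i dν|`, with the sequence `Ψ` indexed from `0`. -/
def measureDist (Ψ : ℕ → C(I, I)) (μ ν : ProbabilityMeasure I) : ℝ :=
  ∑' i : ℕ, (1 / 2 ^ (i + 1)) *
    |(∫ x, (Ψ i x : ℝ) ∂(μ : Measure I)) - ∫ x, (Ψ i x : ℝ) ∂(ν : Measure I)|

/-- The distance from a set `S` of measures to `μ`: the infimum of the distances from its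
elements (and `∞` if `S` is empty). -/
def measureInfDist (Ψ : ℕ → C(I, I)) (S : Set (ProbabilityMeasure I))
    (μ : ProbabilityMeasure I) : ℝ≥0∞ :=
  ⨅ ν ∈ S, ENNReal.ofReal (measureDist Ψ ν μ)

/-- `(1 / (n + 1)) ∑_{j=0}^{n} δ_{f^j x}`; the shift makes the number of atoms positive. -/
def empiricalMeasure (f : C(I, I)) (x : I) (n : ℕ) : ProbabilityMeasure I :=
  ⟨((n + 1 : ℕ) : ℝ≥0∞)⁻¹ • ∑ j ∈ Finset.range (n + 1), Measure.dirac (f^[j] x), by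
    constructor
    simp only [Measure.smul_apply, Measure.coe_finsetSum, Finset.sum_apply, measure_univ,
      Finset.sum_const, Finset.card_range, nsmul_eq_mul, mul_one, smul_eq_mul]
    exact ENNReal.inv_mul_cancel (by simp) (ENNReal.natCast_ne_top _)⟩

/-- The set `pω(x)` of weak-* limits of convergent subsequences of the empirical measures. -/
def pOmega (f : C(I, I)) (x : I) : Set (ProbabilityMeasure I) :=
  {μ | ∃ φ : ℕ → ℕ, StrictMono φ ∧ Tendsto (fun k => empiricalMeasure f x (φ k)) atTop (𝓝 μ)}

/-- The set `O_f` of pseudo-physical measures: for each `ε > 0` the set of points `x` with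
`dist (pω(x), μ) < ε` has positive Lebesgue measure. -/
def pseudoPhysicalMeasures (Ψ : ℕ → C(I, I)) (f : C(I, I)) : Set (ProbabilityMeasure I) :=
  {μ | ∀ ε : ℝ, 0 < ε →
    0 < (volume : Measure I) {x | measureInfDist Ψ (pOmega f x) μ < ENNReal.ofReal ε}}

/-- The set `M_f` of `f`-invariant Borel probability measures. -/
def invariantMeasures (f : C(I, I)) : Set (ProbabilityMeasure I) :=
  {μ | MeasurePreserving f (μ : Measure I) (μ : Measure I)}

/-- The pseudo-physical measures as a subset of the space `M_f`, which carries the subspace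
topology of the weak-* topology. -/
def pseudoPhysicalInInvariant (Ψ : ℕ → C(I, I)) (f : C(I, I)) : Set (invariantMeasures f) :=
  {μ | (μ : ProbabilityMeasure I) ∈ pseudoPhysicalMeasures Ψ f}

end IntervalDynamics

end

open MeasureTheory Filter Topology
open scoped unitInterval ENNReal

/-! For every `f`, a pseudo-physical measure is a weak-* limit of measures in the sets `pω(x)`.
These are invariant and `M_f` is closed, so `O_f ⊆ M_f`; closedness of `O_f` is the triangle
inequality.

For empty interior, suppose `f` maps each of two disjoint closed intervals into its own interior
(`twoTrapMaps`). An orbit cannot enter both traps, so no measure in any `pω(x)` charges both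
interiors; charging both is an open condition, so no pseudo-physical measure does either
(`notMem_pseudoPhysicalMeasures`). Each trap contains a fixed point, hence carries an invariant
point mass. Mixing a little of both masses into any invariant measure leaves `O_f`.

Having two traps is an open condition, and it is dense because a small perturbation near a fixed
point creates them (`dense_twoTrapMaps`). -/

namespace IntervalDynamics

/-! ### The metric on measures and weak-* convergence -/

section MeasureDist

variable (Ψ : ℕ → C(I, I))

/-- A continuous self-map of the interval as a real-valued function. -/
def realValued (g : C(I, I)) : C(I, ℝ) := ⟨fun x => (g x : ℝ), by fun_prop⟩

lemma continuous_integral_coe (g : C(I, I)) :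
    Continuous fun μ : ProbabilityMeasure I => ∫ x, (g x : ℝ) ∂(μ : Measure I) :=
  ProbabilityMeasure.continuous_integral_continuousMap (realValued g)

lemma integrable_coe (g : C(I, I)) (μ : ProbabilityMeasure I) :
    Integrable (fun x => (g x : ℝ)) (μ : Measure I) :=
  (realValued g).continuous.integrable_of_hasCompactSupport (HasCompactSupport.of_compactSpace _)

lemma integral_coe_mem_Icc (g : C(I, I)) (μ : ProbabilityMeasure I) :
    ∫ x, (g x : ℝ) ∂(μ : Measure I) ∈ Set.Icc (0 : ℝ) 1 := by
  refine ⟨integral_nonneg fun x => (g x).2.1, ?_⟩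
  calc ∫ x, (g x : ℝ) ∂(μ : Measure I) ≤ ∫ _, (1 : ℝ) ∂(μ : Measure I) :=
        integral_mono (integrable_coe g μ) (integrable_const _) fun x => (g x).2.2
    _ = 1 := by simp

lemma abs_integral_sub_integral_le_one (g : C(I, I)) (μ ν : ProbabilityMeasure I) :
    |(∫ x, (g x : ℝ) ∂(μ : Measure I)) - ∫ x, (g x : ℝ) ∂(ν : Measure I)| ≤ 1 := by
  have h₁ := integral_coe_mem_Icc g μ
  have h₂ := integral_coe_mem_Icc g ν
  rw [abs_le]
  constructor <;> linarith [h₁.1, h₁.2, h₂.1, h₂.2]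

lemma abs_integral_sub_integral_le_dist (g h : C(I, I)) (μ : ProbabilityMeasure I) :
    |(∫ x, (g x : ℝ) ∂(μ : Measure I)) - ∫ x, (h x : ℝ) ∂(μ : Measure I)| ≤ dist g h := by
  rw [← integral_sub (integrable_coe g μ) (integrable_coe h μ), ← Real.norm_eq_abs]
  refine (norm_integral_le_of_norm_le_const (C := dist g h)
    (ae_of_all _ fun x => ?_)).trans (by simp)
  exact ContinuousMap.dist_apply_le_dist (f := g) (g := h) x

lemma summable_half_pow : Summable fun i : ℕ => (1 / 2 ^ (i + 1) : ℝ) := by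
  refine (summable_geometric_two.mul_left (1 / 2 : ℝ)).congr fun i => ?_
  rw [one_div_pow, pow_succ]
  ring

lemma measureDist_term_le (μ ν : ProbabilityMeasure I) (i : ℕ) :
    (1 / 2 ^ (i + 1)) *
      |(∫ x, (Ψ i x : ℝ) ∂(μ : Measure I)) - ∫ x, (Ψ i x : ℝ) ∂(ν : Measure I)|
      ≤ (1 / 2 ^ (i + 1) : ℝ) :=
  mul_le_of_le_one_right (by positivity) (abs_integral_sub_integral_le_one _ _ _)

lemma summable_measureDist (μ ν : ProbabilityMeasure I) :
    Summable fun i : ℕ => (1 / 2 ^ (i + 1) : ℝ) *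
      |(∫ x, (Ψ i x : ℝ) ∂(μ : Measure I)) - ∫ x, (Ψ i x : ℝ) ∂(ν : Measure I)| :=
  Summable.of_nonneg_of_le (fun _ => by positivity) (measureDist_term_le Ψ μ ν) summable_half_pow

lemma measureDist_nonneg (μ ν : ProbabilityMeasure I) : 0 ≤ measureDist Ψ μ ν :=
  tsum_nonneg fun _ => by positivity

lemma measureDist_triangle (μ ν ρ : ProbabilityMeasure I) :
    measureDist Ψ μ ρ ≤ measureDist Ψ μ ν + measureDist Ψ ν ρ := by
  rw [measureDist, measureDist, measureDist,
    ← (summable_measureDist Ψ μ ν).tsum_add (summable_measureDist Ψ ν ρ)]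
  refine (summable_measureDist Ψ μ ρ).tsum_le_tsum (fun i => ?_)
    ((summable_measureDist Ψ μ ν).add (summable_measureDist Ψ ν ρ))
  rw [← mul_add]
  exact mul_le_mul_of_nonneg_left (abs_sub_le _ _ _) (by positivity)

lemma measureDist_self (μ : ProbabilityMeasure I) : measureDist Ψ μ μ = 0 := by
  simp [measureDist]

lemma continuous_measureDist_left (μ : ProbabilityMeasure I) :
    Continuous fun ν => measureDist Ψ ν μ := by
  refine continuous_tsum (fun i => ?_) summable_half_pow fun i ν => ?_
  · exact continuous_const.mul ((continuous_integral_coe (Ψ i)).sub continuous_const).abs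
  · rw [Real.norm_of_nonneg (by positivity)]
    exact measureDist_term_le Ψ ν μ i

variable {Ψ}

lemma tendsto_integral_of_tendsto_measureDist {ι : Type*} {L : Filter ι}
    {u : ι → ProbabilityMeasure I} {μ : ProbabilityMeasure I}
    (h : Tendsto (fun k => measureDist Ψ (u k) μ) L (𝓝 0)) (i : ℕ) :
    Tendsto (fun k => ∫ x, (Ψ i x : ℝ) ∂(u k : Measure I)) L
      (𝓝 (∫ x, (Ψ i x : ℝ) ∂(μ : Measure I))) := by
  rw [tendsto_iff_dist_tendsto_zero]
  have h' := h.const_mul ((2 : ℝ) ^ (i + 1))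
  rw [mul_zero] at h'
  refine squeeze_zero (fun _ => dist_nonneg) (fun k => ?_) h'
  have hle := (summable_measureDist Ψ (u k) μ).le_tsum i fun j _ => by positivity
  rw [Real.dist_eq]
  calc _ = (2 : ℝ) ^ (i + 1) * ((1 / 2 ^ (i + 1)) *
        |(∫ x, (Ψ i x : ℝ) ∂(u k : Measure I)) - ∫ x, (Ψ i x : ℝ) ∂(μ : Measure I)|) := by
        field_simp
    _ ≤ _ := mul_le_mul_of_nonneg_left hle (by positivity)

/-- Convergence for `measureDist` implies weak-* convergence. -/
lemma tendsto_of_tendsto_measureDist (hΨ : DenseRange Ψ) {ι : Type*} {L : Filter ι}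
    {u : ι → ProbabilityMeasure I} {μ : ProbabilityMeasure I}
    (h : Tendsto (fun k => measureDist Ψ (u k) μ) L (𝓝 0)) : Tendsto u L (𝓝 μ) := by
  have key : ∀ g : C(I, I), Tendsto (fun k => ∫ x, (g x : ℝ) ∂(u k : Measure I)) L
      (𝓝 (∫ x, (g x : ℝ) ∂(μ : Measure I))) := by
    intro g
    rw [Metric.tendsto_nhds]
    intro ε hε
    obtain ⟨i, hi⟩ := hΨ.exists_dist_lt g (show 0 < ε / 3 by positivity)
    filter_upwards [Metric.tendsto_nhds.1 (tendsto_integral_of_tendsto_measureDist h i) (ε / 3)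
      (by positivity)] with k hk
    have h₁ := abs_le.1 (abs_integral_sub_integral_le_dist g (Ψ i) (u k))
    have h₂ := abs_le.1 (abs_integral_sub_integral_le_dist g (Ψ i) μ)
    rw [Real.dist_eq, abs_lt] at hk ⊢
    constructor <;> linarith [h₁.1, h₁.2, h₂.1, h₂.2, hk.1, hk.2]
  rw [ProbabilityMeasure.tendsto_iff_forall_integral_tendsto]
  intro φ
  have hC : 0 < ‖φ‖ + 1 := by positivity
  have hφ : ∀ x, |φ x| ≤ ‖φ‖ := φ.norm_coe_le_norm
  -- Affine rescaling of `φ` into `[0,1]`; the `+ 1` keeps the divisor positive when `φ = 0`.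
  let g : C(I, I) := ⟨fun x => ⟨(φ x / (‖φ‖ + 1) + 1) / 2, by
    have h₁ : -1 ≤ φ x / (‖φ‖ + 1) := by
      rw [le_div_iff₀ hC]; linarith [(abs_le.1 (hφ x)).1]
    have h₂ : φ x / (‖φ‖ + 1) ≤ 1 := by
      rw [div_le_iff₀ hC]; linarith [(abs_le.1 (hφ x)).2]
    constructor <;> linarith⟩, by fun_prop⟩
  have hg : ∀ x, φ x = (‖φ‖ + 1) * (2 * (g x : ℝ) - 1) := by
    intro x
    simp only [g, ContinuousMap.coe_mk]
    field_simp
    ring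
  have hint : ∀ ν : ProbabilityMeasure I, ∫ x, φ x ∂(ν : Measure I) =
      (‖φ‖ + 1) * (2 * (∫ x, (g x : ℝ) ∂(ν : Measure I)) - 1) := by
    intro ν
    rw [integral_congr_ae (ae_of_all _ hg), integral_const_mul,
      integral_sub ((integrable_coe g ν).const_mul 2) (integrable_const _), integral_const_mul]
    simp
  simp only [hint]
  exact (((key g).const_mul 2).sub_const 1).const_mul _

end MeasureDist

/-! ### Closedness and invariance, valid for every map -/

section PseudoPhysical

variable {Ψ : ℕ → C(I, I)} {f : C(I, I)}

lemma exists_mem_measureDist_lt_of_measureInfDist_lt {S : Set (ProbabilityMeasure I)}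
    {μ : ProbabilityMeasure I} {ε : ℝ} (hε : 0 < ε)
    (h : measureInfDist Ψ S μ < ENNReal.ofReal ε) : ∃ ν ∈ S, measureDist Ψ ν μ < ε := by
  simp only [measureInfDist, iInf_lt_iff] at h
  obtain ⟨ν, hν, h⟩ := h
  exact ⟨ν, hν, (ENNReal.ofReal_lt_ofReal_iff hε).1 h⟩

/-- Positive Lebesgue measure enters only through nonemptiness: it yields one point `x` for each
`ε`. -/
lemma pseudoPhysicalMeasures_subset_closure (hΨ : DenseRange Ψ) :
    pseudoPhysicalMeasures Ψ f ⊆ closure (⋃ x, pOmega f x) := by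
  intro μ hμ
  have hex : ∀ n : ℕ, ∃ ν ∈ ⋃ x, pOmega f x, measureDist Ψ ν μ < 1 / ((n : ℝ) + 1) := by
    intro n
    have hn : 0 < 1 / ((n : ℝ) + 1) := Nat.one_div_pos_of_nat
    obtain ⟨x, hx⟩ := nonempty_of_measure_ne_zero (hμ _ hn).ne'
    obtain ⟨ν, hν, hlt⟩ := exists_mem_measureDist_lt_of_measureInfDist_lt hn hx
    exact ⟨ν, Set.mem_iUnion.2 ⟨x, hν⟩, hlt⟩
  choose u hu hlt using hex
  refine mem_closure_of_tendsto (tendsto_of_tendsto_measureDist (L := atTop) (u := u) hΨ ?_)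
    (Eventually.of_forall hu)
  exact squeeze_zero (fun _ => measureDist_nonneg _ _ _) (fun n => (hlt n).le)
    tendsto_one_div_add_atTop_nhds_zero_nat

lemma isClosed_pseudoPhysicalMeasures : IsClosed (pseudoPhysicalMeasures Ψ f) := by
  rw [isClosed_iff_clusterPt]
  intro μ hμ ε hε
  have hnhds : ∀ᶠ ν in 𝓝 μ, measureDist Ψ ν μ < ε / 2 := by
    refine (continuous_measureDist_left Ψ μ).continuousAt.eventually_lt continuousAt_const ?_
    simpa [measureDist_self] using hε
  obtain ⟨ν, hν, hmem⟩ := (clusterPt_iff_nonempty.1 hμ) hnhds (mem_principal_self _)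
  refine (hmem (ε / 2) (by positivity)).trans_le (measure_mono fun x hx => ?_)
  obtain ⟨ρ, hρ, hlt⟩ := exists_mem_measureDist_lt_of_measureInfDist_lt (by positivity) hx
  refine lt_of_le_of_lt (b := ENNReal.ofReal (measureDist Ψ ρ μ)) (iInf₂_le ρ hρ)
    ((ENNReal.ofReal_lt_ofReal_iff hε).2 ?_)
  have := measureDist_triangle Ψ ρ ν μ
  have hν' : measureDist Ψ ν μ < ε / 2 := hν
  linarith

lemma mem_invariantMeasures_iff {μ : ProbabilityMeasure I} :
    μ ∈ invariantMeasures f ↔ μ.map f.continuous.aemeasurable = μ := by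
  constructor
  · intro h
    exact Subtype.ext (MeasurePreserving.map_eq h)
  · intro h
    exact ⟨f.continuous.measurable, congrArg Subtype.val h⟩

lemma isClosed_invariantMeasures : IsClosed (invariantMeasures f) := by
  have : invariantMeasures f =
      {μ : ProbabilityMeasure I | μ.map f.continuous.aemeasurable = μ} :=
    Set.ext fun _ => mem_invariantMeasures_iff
  rw [this]
  exact isClosed_eq (ProbabilityMeasure.continuous_map f.continuous) continuous_id

lemma integral_empiricalMeasure (x : I) (n : ℕ) (φ : I → ℝ) :
    ∫ y, φ y ∂(empiricalMeasure f x n : Measure I) =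
      ((n : ℝ) + 1)⁻¹ * ∑ j ∈ Finset.range (n + 1), φ (f^[j] x) := by
  have : (empiricalMeasure f x n : Measure I) =
      ((n + 1 : ℕ) : ℝ≥0∞)⁻¹ • ∑ j ∈ Finset.range (n + 1), Measure.dirac (f^[j] x) := rfl
  rw [this, integral_smul_measure, integral_finsetSum_measure]
  · rw [ENNReal.toReal_inv, ENNReal.toReal_natCast]
    simp
  · intro i _
    exact integrable_dirac (by simp)

/-- Krylov–Bogolyubov: the integrals of `φ ∘ f` and `φ` against an empirical measure differ by a
telescoping sum, at most `2‖φ‖ / (n + 1)`. -/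
lemma pOmega_subset_invariantMeasures (x : I) : pOmega f x ⊆ invariantMeasures f := by
  rintro μ ⟨θ, hθ, hlim⟩
  refine ⟨f.continuous.measurable, ?_⟩
  have := Measure.isProbabilityMeasure_map (μ := (μ : Measure I)) f.continuous.aemeasurable
  refine ext_of_forall_integral_eq_of_IsFiniteMeasure fun φ => ?_
  rw [integral_map f.continuous.aemeasurable φ.continuous.aestronglyMeasurable]
  rw [ProbabilityMeasure.tendsto_iff_forall_integral_tendsto] at hlim
  have h₁ := hlim (φ.compContinuous f)
  have h₂ := hlim φ
  refine sub_eq_zero.1 (tendsto_nhds_unique (h₁.sub h₂) ?_)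
  have hb : Tendsto (fun n : ℕ => 2 * ‖φ‖ * (1 / ((n : ℝ) + 1))) atTop (𝓝 0) := by
    simpa using tendsto_one_div_add_atTop_nhds_zero_nat.const_mul (2 * ‖φ‖)
  refine squeeze_zero_norm (fun k => ?_) (hb.comp hθ.tendsto_atTop)
  simp only [integral_empiricalMeasure, ← mul_sub, ← Finset.sum_sub_distrib,
    BoundedContinuousFunction.compContinuous_apply, Function.comp_apply]
  have hs := Finset.sum_range_sub (fun j => φ (f^[j] x)) (θ k + 1)
  simp only [Function.iterate_succ_apply'] at hs ⊢
  rw [hs, norm_mul, norm_inv, Real.norm_of_nonneg (by positivity : (0 : ℝ) ≤ (θ k : ℝ) + 1),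
    one_div, mul_comm]
  refine mul_le_mul_of_nonneg_right ?_ (by positivity)
  calc _ ≤ ‖φ _‖ + ‖φ _‖ := norm_sub_le _ _
    _ ≤ ‖φ‖ + ‖φ‖ := add_le_add (φ.norm_coe_le_norm _) (φ.norm_coe_le_norm _)
    _ = _ := by ring

lemma pseudoPhysicalMeasures_subset_invariantMeasures (hΨ : DenseRange Ψ) :
    pseudoPhysicalMeasures Ψ f ⊆ invariantMeasures f :=
  (pseudoPhysicalMeasures_subset_closure hΨ).trans <| closure_minimal
    (Set.iUnion_subset pOmega_subset_invariantMeasures) isClosed_invariantMeasures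

end PseudoPhysical

/-! ### Disjoint forward-invariant open sets -/

section Traps

variable {Ψ : ℕ → C(I, I)} {f : C(I, I)} {U V : Set I}

lemma isOpen_measure_pos (hU : IsOpen U) :
    IsOpen {μ : ProbabilityMeasure I | 0 < (μ : Measure I) U} := by
  rw [isOpen_iff_mem_nhds]
  intro μ hμ
  exact eventually_lt_of_lt_liminf (lt_of_lt_of_le hμ
    (ProbabilityMeasure.le_liminf_measure_open_of_tendsto (tendsto_id (x := 𝓝 μ)) hU))

lemma exists_iterate_mem_of_empiricalMeasure_pos {x : I} {n : ℕ}
    (h : 0 < (empiricalMeasure f x n : Measure I) U) : ∃ j, f^[j] x ∈ U := by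
  by_contra! hU
  refine h.ne' ?_
  have hrfl : (empiricalMeasure f x n : Measure I) =
      ((n + 1 : ℕ) : ℝ≥0∞)⁻¹ • ∑ j ∈ Finset.range (n + 1), Measure.dirac (f^[j] x) := rfl
  have : ∀ j, Measure.dirac (f^[j] x) U = 0 := fun j => by
    rw [Measure.dirac_apply, Set.indicator_of_notMem (hU j)]
  simp [hrfl, Measure.finsetSum_apply, this]

/-- A pseudo-physical measure cannot charge two disjoint forward-invariant open sets. -/
lemma notMem_pseudoPhysicalMeasures (hΨ : DenseRange Ψ) (hU : IsOpen U) (hV : IsOpen V)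
    (hUV : Disjoint U V) (hfU : Set.MapsTo f U U) (hfV : Set.MapsTo f V V)
    {μ : ProbabilityMeasure I} (hμU : 0 < (μ : Measure I) U) (hμV : 0 < (μ : Measure I) V) :
    μ ∉ pseudoPhysicalMeasures Ψ f := by
  intro hμ
  have hopen := (isOpen_measure_pos hU).inter (isOpen_measure_pos hV)
  obtain ⟨ν, hν, hmem⟩ := mem_closure_iff.1 (pseudoPhysicalMeasures_subset_closure hΨ hμ) _
    hopen ⟨hμU, hμV⟩
  obtain ⟨x, θ, -, hlim⟩ := Set.mem_iUnion.1 hmem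
  obtain ⟨k, hkU, hkV⟩ := (hlim.eventually (hopen.mem_nhds hν)).exists
  obtain ⟨i, hi⟩ := exists_iterate_mem_of_empiricalMeasure_pos hkU
  obtain ⟨j, hj⟩ := exists_iterate_mem_of_empiricalMeasure_pos hkV
  -- By time `i + j` the orbit has entered both invariant sets and left neither.
  refine hUV.ne_of_mem (a := f^[i + j] x) (b := f^[i + j] x) ?_ ?_ rfl
  · rw [add_comm, Function.iterate_add_apply]
    exact hfU.iterate j hi
  · rw [Function.iterate_add_apply]
    exact hfV.iterate i hj

/-- The convex combination `(1 - t) μ + t ν`. -/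
noncomputable def mixture (t : I) (μ ν : ProbabilityMeasure I) : ProbabilityMeasure I :=
  ⟨ENNReal.ofReal (1 - t) • (μ : Measure I) + ENNReal.ofReal t • (ν : Measure I), by
    constructor
    simp only [Measure.add_apply, Measure.smul_apply, measure_univ, smul_eq_mul, mul_one]
    rw [← ENNReal.ofReal_add (by linarith [t.2.2]) t.2.1]
    simp⟩

lemma coe_mixture (t : I) (μ ν : ProbabilityMeasure I) : (mixture t μ ν : Measure I) =
    ENNReal.ofReal (1 - t) • (μ : Measure I) + ENNReal.ofReal t • (ν : Measure I) := rfl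

lemma mixture_mem_invariantMeasures (t : I) {μ ν : ProbabilityMeasure I}
    (hμ : μ ∈ invariantMeasures f) (hν : ν ∈ invariantMeasures f) :
    mixture t μ ν ∈ invariantMeasures f := by
  refine ⟨f.continuous.measurable, ?_⟩
  rw [coe_mixture, Measure.map_add _ _ f.continuous.measurable, Measure.map_smul,
    Measure.map_smul, MeasurePreserving.map_eq hμ, MeasurePreserving.map_eq hν]

lemma mixture_pos_left {t : I} (ht : (t : ℝ) < 1) {μ : ProbabilityMeasure I}
    (ν : ProbabilityMeasure I) (h : 0 < (μ : Measure I) U) :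
    0 < (mixture t μ ν : Measure I) U := by
  rw [coe_mixture, Measure.add_apply, Measure.smul_apply, smul_eq_mul]
  exact (ENNReal.mul_pos (ENNReal.ofReal_pos.2 (by linarith)).ne' h.ne').trans_le le_self_add

lemma mixture_pos_right {t : I} (ht : 0 < (t : ℝ)) (μ : ProbabilityMeasure I)
    {ν : ProbabilityMeasure I} (h : 0 < (ν : Measure I) U) :
    0 < (mixture t μ ν : Measure I) U := by
  rw [coe_mixture, Measure.add_apply, Measure.smul_apply, Measure.smul_apply, smul_eq_mul,
    smul_eq_mul]
  exact (ENNReal.mul_pos (ENNReal.ofReal_pos.2 ht).ne' h.ne').trans_le le_add_self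

lemma tendsto_mixture {t : ℕ → I} (ht : Tendsto (fun n => (t n : ℝ)) atTop (𝓝 0))
    (μ ν : ProbabilityMeasure I) : Tendsto (fun n => mixture (t n) μ ν) atTop (𝓝 μ) := by
  rw [ProbabilityMeasure.tendsto_iff_forall_integral_tendsto]
  intro φ
  have hint : ∀ n, ∫ x, φ x ∂(mixture (t n) μ ν : Measure I) =
      (1 - t n) * ∫ x, φ x ∂(μ : Measure I) + t n * ∫ x, φ x ∂(ν : Measure I) := by
    intro n
    rw [coe_mixture, integral_add_measure, integral_smul_measure, integral_smul_measure,
      ENNReal.toReal_ofReal (by linarith [(t n).2.2]), ENNReal.toReal_ofReal (t n).2.1]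
    · rfl
    · exact (φ.integrable _).smul_measure ENNReal.ofReal_ne_top
    · exact (φ.integrable _).smul_measure ENNReal.ofReal_ne_top
  simp only [hint]
  simpa using ((ht.const_sub 1).mul_const (∫ x, φ x ∂(μ : Measure I))).add
    (ht.mul_const (∫ x, φ x ∂(ν : Measure I)))

/-- Any invariant `μ` is the limit of its mixtures with `(ρ + τ) / 2` as the weight of the latter
tends to zero; each mixture charges both `U` and `V`. -/
lemma dense_compl_pseudoPhysicalInInvariant (hΨ : DenseRange Ψ) (hU : IsOpen U) (hV : IsOpen V)
    (hUV : Disjoint U V) (hfU : Set.MapsTo f U U) (hfV : Set.MapsTo f V V)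
    {ρ τ : ProbabilityMeasure I} (hρ : ρ ∈ invariantMeasures f) (hτ : τ ∈ invariantMeasures f)
    (hρU : 0 < (ρ : Measure I) U) (hτV : 0 < (τ : Measure I) V) :
    Dense (pseudoPhysicalInInvariant Ψ f)ᶜ := by
  rintro ⟨μ, hμ⟩
  let s : I := ⟨1 / 2, by norm_num, by norm_num⟩
  let t : ℕ → I := fun n => ⟨1 / ((n : ℝ) + 1), Nat.one_div_pos_of_nat.le, by
    rw [div_le_one (by positivity)]; linarith [n.cast_nonneg (α := ℝ)]⟩
  have hη := mixture_mem_invariantMeasures s hρ hτ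
  have hpos : ∀ n, 0 < (t n : ℝ) := fun n => Nat.one_div_pos_of_nat
  refine mem_closure_of_tendsto (b := atTop)
    (f := fun n => (⟨mixture (t n) μ (mixture s ρ τ), mixture_mem_invariantMeasures _ hμ hη⟩ :
      invariantMeasures f)) ?_ (Eventually.of_forall fun n => ?_)
  · rw [tendsto_subtype_rng]
    exact tendsto_mixture tendsto_one_div_add_atTop_nhds_zero_nat _ _
  · refine notMem_pseudoPhysicalMeasures hΨ hU hV hUV hfU hfV ?_ ?_
    · exact mixture_pos_right (hpos n) _ (mixture_pos_left (by norm_num [s]) _ hρU)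
    · exact mixture_pos_right (hpos n) _ (mixture_pos_right (by norm_num [s]) _ hτV)

/-- A point mass at a fixed point is invariant. -/
lemma dirac_mem_invariantMeasures {p : I} (hp : Function.IsFixedPt f p) :
    (⟨Measure.dirac p, inferInstance⟩ : ProbabilityMeasure I) ∈ invariantMeasures f := by
  refine ⟨f.continuous.measurable, ?_⟩
  rw [ProbabilityMeasure.coe_mk, Measure.map_dirac' f.continuous.measurable, hp.eq]

lemma exists_invariant_of_mapsTo_Icc_Ioo {a b : I} (hab : a < b)
    (h : Set.MapsTo f (Set.Icc a b) (Set.Ioo a b)) :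
    ∃ ρ ∈ invariantMeasures f, 0 < (ρ : Measure I) (Set.Ioo a b) := by
  obtain ⟨p, hp, hfix⟩ := exists_mem_Icc_isFixedPt_of_mapsTo f.continuous.continuousOn hab.le
    (h.mono_right Set.Ioo_subset_Icc_self)
  refine ⟨_, dirac_mem_invariantMeasures hfix, ?_⟩
  have : p ∈ Set.Ioo a b := hfix.eq ▸ h hp
  simp [this]

end Traps

/-! ### Two traps are an open and dense condition -/

section Typical

/-- The maps that send each of two disjoint closed intervals into its own interior. -/
def twoTrapMaps : Set C(I, I) :=
  {f | ∃ a b c d : I, a < b ∧ b < c ∧ c < d ∧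
    Set.MapsTo f (Set.Icc a b) (Set.Ioo a b) ∧ Set.MapsTo f (Set.Icc c d) (Set.Ioo c d)}

lemma isOpen_twoTrapMaps : IsOpen twoTrapMaps := by
  rw [isOpen_iff_mem_nhds]
  rintro f ⟨a, b, c, d, hab, hbc, hcd, h₁, h₂⟩
  filter_upwards [ContinuousMap.eventually_mapsTo isCompact_Icc isOpen_Ioo h₁,
    ContinuousMap.eventually_mapsTo isCompact_Icc isOpen_Ioo h₂] with g hg₁ hg₂
  exact ⟨a, b, c, d, hab, hbc, hcd, hg₁, hg₂⟩

/-- A map that is `ε`-close to the constant `c` on an open set can be made equal to `c` on a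
closed subset by a perturbation of size `ε` supported in that open set. -/
lemma exists_dist_le_eqOn_const (f : C(I, I)) {K W : Set I} (hK : IsClosed K) (hW : IsOpen W)
    (hKW : K ⊆ W) (c : I) {ε : ℝ} (hε : 0 ≤ ε) (hf : ∀ x ∈ W, dist (f x) c ≤ ε) :
    ∃ g : C(I, I), dist g f ≤ ε ∧ (∀ x ∈ K, g x = c) ∧ ∀ x ∉ W, g x = f x := by
  obtain ⟨χ, hχ₀, hχ₁, hχ⟩ := exists_continuous_zero_one_of_isClosed hW.isClosed_compl hK
    (Set.disjoint_left.2 fun x hx hxK => hx (hKW hxK))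
  let g : C(I, I) := ⟨fun x => ⟨(1 - χ x) * f x + χ x * c,
    convex_Icc (0 : ℝ) 1 (f x).2 c.2 (by linarith [(hχ x).2]) (hχ x).1 (by ring)⟩, by fun_prop⟩
  have hg : ∀ x, (g x : ℝ) = (1 - χ x) * f x + χ x * c := fun _ => rfl
  refine ⟨g, (ContinuousMap.dist_le hε).2 fun x => ?_, fun x hx => ?_, fun x hx => ?_⟩
  · have hd : dist (g x) (f x) = χ x * dist (f x) c := by
      rw [Subtype.dist_eq, Subtype.dist_eq, Real.dist_eq, Real.dist_eq, hg,
        show (1 - χ x) * (f x : ℝ) + χ x * c - f x = χ x * (c - f x) by ring, abs_mul,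
        abs_of_nonneg (hχ x).1, abs_sub_comm]
    rw [hd]
    by_cases hx : x ∈ W
    · exact (mul_le_of_le_one_left dist_nonneg (hχ x).2).trans (hf x hx)
    · simpa [hχ₀ hx] using hε
  · exact Subtype.ext (by simp [hg, hχ₁ hx])
  · exact Subtype.ext (by simp [hg, hχ₀ hx])

/-- A one-sided interval at `p` suffices, which covers `p = 0` and `p = 1`. -/
lemma exists_Icc_subset_of_mem_nhds {p : I} {W : Set I} (hW : W ∈ 𝓝 p) :
    ∃ a b : I, a < b ∧ Set.Icc a b ⊆ W := by
  rcases (unitInterval.le_one' (t := p)).lt_or_eq with hp | hp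
  · obtain ⟨u, hu, hsub⟩ := exists_Ico_subset_of_mem_nhds hW ⟨1, hp⟩
    obtain ⟨v, hv, hvu⟩ := exists_between hu
    exact ⟨p, v, hv, (Set.Icc_subset_Ico_right hvu).trans hsub⟩
  · obtain ⟨u, hu, hsub⟩ := exists_Ioc_subset_of_mem_nhds hW ⟨0, hp ▸ zero_lt_one⟩
    obtain ⟨v, huv, hv⟩ := exists_between hu
    exact ⟨v, p, hv, (Set.Icc_subset_Ioc_left huv).trans hsub⟩

lemma dense_twoTrapMaps : Dense twoTrapMaps := by
  rw [Metric.dense_iff]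
  intro f ε hε
  obtain ⟨p, -, hp⟩ := exists_mem_Icc_isFixedPt_of_mapsTo (a := (0 : I)) (b := 1)
    f.continuous.continuousOn zero_le_one
    fun x _ => ⟨unitInterval.nonneg', unitInterval.le_one'⟩
  -- On `W`, values of `f` and points are both within `ε / 6` of `p`, so each of the two
  -- perturbations costs at most `ε / 3`.
  have hε' : 0 < ε / 6 := by positivity
  let W : Set I := f ⁻¹' Metric.ball p (ε / 6) ∩ Metric.ball p (ε / 6)
  have hWo : IsOpen W := (Metric.isOpen_ball.preimage f.continuous).inter Metric.isOpen_ball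
  have hpW : p ∈ W := ⟨by simpa [hp.eq] using hε', Metric.mem_ball_self hε'⟩
  have hclose : ∀ x ∈ W, ∀ y ∈ W, dist (f x) y ≤ ε / 3 := by
    intro x hx y hy
    have h₁ : dist (f x) p < ε / 6 := hx.1
    have h₂ : dist y p < ε / 6 := hy.2
    linarith [dist_triangle_right (f x) y p]
  obtain ⟨a, d, had, hsub⟩ := exists_Icc_subset_of_mem_nhds (hWo.mem_nhds hpW)
  -- The point `m` separates the supports of the two perturbations, so the second leaves the first
  -- trap intact.
  obtain ⟨m, ham, hmd⟩ := exists_between had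
  obtain ⟨b, hab, hbm⟩ := exists_between ham
  obtain ⟨c, hmc, hcd⟩ := exists_between hmd
  obtain ⟨q, haq, hqb⟩ := exists_between hab
  obtain ⟨r, hcr, hrd⟩ := exists_between hcd
  obtain ⟨g, hgf, hgq, hgW⟩ := exists_dist_le_eqOn_const f (K := Set.Icc a b)
    (W := W ∩ Set.Iio m) isClosed_Icc (hWo.inter isOpen_Iio)
    (fun x hx => ⟨hsub ⟨hx.1, by order [hx.2]⟩, hx.2.trans_lt hbm⟩) q (by positivity : 0 ≤ ε / 3)
    (fun x hx => hclose x hx.1 q (hsub ⟨haq.le, by order⟩))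
  obtain ⟨h, hhg, hhr, hhW⟩ := exists_dist_le_eqOn_const g (K := Set.Icc c d)
    (W := W ∩ Set.Ioi m) isClosed_Icc (hWo.inter isOpen_Ioi)
    (fun x hx => ⟨hsub ⟨by order [hx.1], hx.2⟩, hmc.trans_le hx.1⟩) r (by positivity : 0 ≤ ε / 3)
    (fun x hx => by
      rw [hgW x fun hx' => lt_asymm (Set.mem_Ioi.1 hx.2) (Set.mem_Iio.1 hx'.2)]
      exact hclose x hx.1 r (hsub ⟨by order, hrd.le⟩))
  refine ⟨h, ?_, a, b, c, d, hab, hbm.trans hmc, hcd, fun x hx => ?_, fun x hx => ?_⟩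
  · rw [Metric.mem_ball]
    linarith [dist_triangle h g f]
  · rw [hhW x fun hx' => lt_asymm (hx.2.trans_lt hbm) hx'.2, hgq x hx]
    exact ⟨haq, hqb⟩
  · rw [hhr x hx]
    exact ⟨hcr, hrd⟩

lemma dense_compl_of_mem_twoTrapMaps {Ψ : ℕ → C(I, I)} (hΨ : DenseRange Ψ) {f : C(I, I)}
    (hf : f ∈ twoTrapMaps) : Dense (pseudoPhysicalInInvariant Ψ f)ᶜ := by
  obtain ⟨a, b, c, d, hab, hbc, hcd, h₁, h₂⟩ := hf
  obtain ⟨ρ, hρ, hρU⟩ := exists_invariant_of_mapsTo_Icc_Ioo hab h₁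
  obtain ⟨τ, hτ, hτV⟩ := exists_invariant_of_mapsTo_Icc_Ioo hcd h₂
  refine dense_compl_pseudoPhysicalInInvariant hΨ isOpen_Ioo isOpen_Ioo ?_
    (h₁.mono_left Set.Ioo_subset_Icc_self) (h₂.mono_left Set.Ioo_subset_Icc_self) hρ hτ hρU hτV
  exact Set.disjoint_left.2 fun x hx hx' => lt_asymm (hx.2.trans hbc) hx'.1

end Typical

end IntervalDynamics

theorem mainTheorem2 (Ψ : ℕ → C(unitInterval, unitInterval)) (hΨ : DenseRange Ψ) :
    IntervalDynamics.IsTypical fun f =>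
      IntervalDynamics.pseudoPhysicalMeasures Ψ f ⊆ IntervalDynamics.invariantMeasures f ∧
      IsClosed (IntervalDynamics.pseudoPhysicalInInvariant Ψ f) ∧
      interior (IntervalDynamics.pseudoPhysicalInInvariant Ψ f) = ∅ ∧
      IsMeagre (IntervalDynamics.pseudoPhysicalInInvariant Ψ f) ∧
      Dense (IntervalDynamics.pseudoPhysicalInInvariant Ψ f)ᶜ := by
  refine ⟨IntervalDynamics.twoTrapMaps, IntervalDynamics.isOpen_twoTrapMaps.isGδ,
    IntervalDynamics.dense_twoTrapMaps, fun f hf => ?_⟩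
  have hclosed : IsClosed (IntervalDynamics.pseudoPhysicalInInvariant Ψ f) :=
    IntervalDynamics.isClosed_pseudoPhysicalMeasures.preimage continuous_subtype_val
  have hdense := IntervalDynamics.dense_compl_of_mem_twoTrapMaps hΨ hf
  have hint := interior_eq_empty_iff_dense_compl.2 hdense
  exact ⟨IntervalDynamics.pseudoPhysicalMeasures_subset_invariantMeasures hΨ, hclosed, hint,
    (hclosed.isNowhereDense_iff.2 hint).isMeagre, hdense⟩
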